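/- Let $d<M$ be non-negative integers, $Q=[0,2\pi)^M$ and $Y'=[-\tfrac12,\tfrac12)^d$. Let $A=(a_{kl})_{k,l=1}^d$ be a matrix of smooth, bounded, real-valued functions on $\mathbb{R}^d$ such that (i) $A$ is quasiperiodic: there are a $d\times d$ matrix $B=(b_{kl})$ of smooth, real-valued, $Q$-periodic functions on $\mathbb{R}^M$ (that is, $2\pi$-periodic in each variable) and a constant real $M\times d$ matrix $\Lambda$ with $A(x)=B(\Lambda x)$ for all $x\in\mathbb{R}^d$ and $\Lambda^T p\neq 0$ for every non-zero $p\in\mathbb{Z}^M$; (ii) $A$ is symmetric, $a_{kl}=a_{lk}$; (iii) $A$ is coercive: there is $\alpha>0$ such that $\langle A(x)v,v\rangle\ge\alpha\|v\|^2$ for all $v\in\mathbb{R}^d$ and a.e. $x\in\mathbb{R}^d$. Let $L^2_\sharp(Q)$ be the space of complex-valued $Q$-periodic functions that are square integrable on $Q$, and let $H^1_\sharp(Q)$ be the space of those $u\in L^2_\sharp(Q)$ whose periodic distributional gradient $\nabla u$ lies in $L^2_\sharp(Q)^M$, with the norm $(\|u\|_{L^2(Q)}^2+\|\nabla u\|_{L^2(Q)}^2)^{1/2}$.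 Put $D=\Lambda^T\nabla_y$. For $0<\delta<1$ and $\eta\in\mathbb{R}^d$ consider on $H^1_\sharp(Q)$ the form $$a^\delta[\eta](u,v)=\int_Q B\,(D+i\eta)u\cdot\overline{(D+i\eta)v}\,dy+\delta\int_Q\nabla u\cdot\overline{\nabla v}\,dy$$ of the operator $\mathcal{C}^\delta(\eta)=-(D+i\eta)\cdot B(D+i\eta)-\delta\Delta$. A real number $\lambda$ is a regularized Bloch eigenvalue at $\eta$, with eigenfunction $\phi$, if $0\neq\phi\in H^1_\sharp(Q)$ and $a^\delta[\eta](\phi,v)=\lambda\int_Q\phi\,\overline{v}\,dy$ for all $v\in H^1_\sharp(Q)$. The smallest regularized Bloch eigenvalue at $\eta$ is called the first one and is denoted by $\lambda_1^\delta(\eta)$. **Theorem.** For every $0<\delta<1$ there is $\theta_\delta>0$ such that the ball $U^\delta=\{\eta\in\mathbb{R}^d:|\eta|<\theta_\delta\}$ is contained in $Y'$, the smallest regularized Bloch eigenvalue $\lambda_1^\delta(\eta)$ exists for every $\eta\in U^\delta$, and 1. the function $\eta\mapsto\lambda_1^\delta(\eta)$ is real-analytic on $U^\delta$; 2. for $\eta\in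 U^\delta$ one can choose eigenfunctions $\phi_1^\delta(\cdot,\eta)$ for the eigenvalue $\lambda_1^\delta(\eta)$ such that $\eta\mapsto\phi_1^\delta(\cdot,\eta)\in H^1_\sharp(Q)$ is real-analytic on $U^\delta$. -/

import Mathlib

open MeasureTheory
open scoped Matrix ContDiff

noncomputable section

namespace QuasiBloch

/-- The cell `Q = [0, 2π)^M`, a parametrization of the torus `ℝ^M / 2πℤ^M`. -/
def cell (M : ℕ) : Set (Fin M → ℝ) :=
  Set.univ.pi fun _ => Set.Ico 0 (2 * Real.pi)

/-- The complex Hilbert space `L²_♯(Q)` of periodic functions, identified with `L²(Q)`. -/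
abbrev L2per (M : ℕ) : Type :=
  Lp ℂ 2 ((volume : Measure (Fin M → ℝ)).restrict (cell M))

/-- The Fourier coefficient `û(n) = (2π)^{-M} ∫_Q u(y) e^{-i n·y} dy`, for `n ∈ ℤ^M`. -/
def fourierCoef {M : ℕ} (u : L2per M) (n : Fin M → ℤ) : ℂ :=
  ((2 * Real.pi : ℝ) : ℂ)⁻¹ ^ M *
    ∫ y in cell M, u y * Complex.exp (-(Complex.I * ∑ j, (n j : ℂ) * (y j : ℂ)))

/-- The integrand of a Fourier coefficient is integrable. -/
theorem integrable_fourier {M : ℕ} (u : L2per M) (n : Fin M → ℤ) :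
    Integrable (fun y : Fin M → ℝ =>
      u y * Complex.exp (-(Complex.I * ∑ j, (n j : ℂ) * (y j : ℂ))))
      ((volume : Measure (Fin M → ℝ)).restrict (cell M)) := by
  have hfin : IsFiniteMeasure ((volume : Measure (Fin M → ℝ)).restrict (cell M)) := by
    refine ⟨?_⟩
    rw [Measure.restrict_apply_univ, cell, Real.volume_pi_Ico]
    exact ENNReal.prod_lt_top fun _ _ => ENNReal.ofReal_lt_top
  have hu : Integrable u ((volume : Measure (Fin M → ℝ)).restrict (cell M)) :=
    (Lp.memLp u).integrable one_le_two
  refine hu.mul_bdd (c := 1) ?_ ?_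
  · have hc : Continuous fun y : Fin M → ℝ =>
        Complex.exp (-(Complex.I * ∑ j, (n j : ℂ) * (y j : ℂ))) := by fun_prop
    exact hc.aestronglyMeasurable
  · refine Filter.Eventually.of_forall fun y => ?_
    rw [Complex.norm_exp]
    simp [Complex.mul_re]

theorem fourierCoef_add {M : ℕ} (u v : L2per M) (n : Fin M → ℤ) :
    fourierCoef (u + v) n = fourierCoef u n + fourierCoef v n := by
  rw [fourierCoef, fourierCoef, fourierCoef, ← mul_add,
    ← integral_add (integrable_fourier u n) (integrable_fourier v n)]
  congr 1
  refine integral_congr_ae ?_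
  filter_upwards [Lp.coeFn_add u v] with y hy
  rw [hy, Pi.add_apply, add_mul]

theorem fourierCoef_smul {M : ℕ} (c : ℂ) (u : L2per M) (n : Fin M → ℤ) :
    fourierCoef (c • u) n = c * fourierCoef u n := by
  rw [fourierCoef, fourierCoef, mul_left_comm, ← integral_const_mul c]
  congr 1
  refine integral_congr_ae ?_
  filter_upwards [Lp.coeFn_smul c u] with y hy
  rw [hy, Pi.smul_apply, smul_eq_mul, mul_assoc]

/-- `H¹_♯(Q)`: the periodic functions `u ∈ L²_♯(Q)` whose periodic distributional derivatives
`∂_j u` (the distributions with Fourier coefficients `i n_j û(n)`) all lie in `L²_♯(Q)`.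
An element is stored as the family `(u, ∂_1 u, …, ∂_M u)`, with `u` at index `none` and `∂_j u`
at index `some j`; the derivatives are determined by `u`. The norm inherited from the `ℓ²`-product
is `(‖u‖² + ∑_j ‖∂_j u‖²)^{1/2}`, which is `(2π)^{M/2} (∑_n (1 + |n|²) |û(n)|²)^{1/2}`. -/
def H1perSubmodule (M : ℕ) : Submodule ℂ (PiLp 2 fun _ : Option (Fin M) => L2per M) where
  carrier := {w | ∀ (j : Fin M) (n : Fin M → ℤ),
    fourierCoef (w (some j)) n = Complex.I * (n j : ℂ) * fourierCoef (w none) n}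
  zero_mem' := by
    intro j n
    have h0 : fourierCoef (0 : L2per M) n = 0 := by
      simpa using fourierCoef_smul 0 (0 : L2per M) n
    simp [h0]
  add_mem' := by
    intro w z hw hz j n
    have h1 := hw j n
    have h2 := hz j n
    simp only [PiLp.add_apply, fourierCoef_add, h1, h2]
    ring
  smul_mem' := by
    intro c w hw j n
    have h1 := hw j n
    simp only [PiLp.smul_apply, fourierCoef_smul, h1]
    ring

/-- The type of elements of `H¹_♯(Q)`, a complex normed space. -/
abbrev H1per (M : ℕ) : Type := H1perSubmodule M

/-- The function `u ∈ L²_♯(Q)` underlying an element of `H¹_♯(Q)`. -/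
def toL2 {M : ℕ} (u : H1per M) : L2per M := u.1 none

/-- The weak partial derivative `∂u/∂y_j ∈ L²_♯(Q)`. -/
def partialD {M : ℕ} (u : H1per M) (j : Fin M) : L2per M := u.1 (some j)

/-- The `k`-th component of `(D + iη) u`, where `D = Λᵀ ∇_y`. -/
def shiftedD {d M : ℕ} (Λ : Matrix (Fin M) (Fin d) ℝ) (η : EuclideanSpace ℝ (Fin d))
    (u : H1per M) (k : Fin d) : L2per M :=
  (∑ j, (Λ j k : ℂ) • partialD u j) + (Complex.I * (η k : ℂ)) • toL2 u

/-- The sesquilinear form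
`a^δ[η](u, v) = ∫_Q B (D + iη)u · conj((D + iη)v) dy + δ ∫_Q ∇u · conj(∇v) dy`
of the operator `C^δ(η) = -(D + iη)·B(D + iη) - δΔ`. -/
def blochForm {d M : ℕ} (Λ : Matrix (Fin M) (Fin d) ℝ)
    (B : (Fin M → ℝ) → Matrix (Fin d) (Fin d) ℝ) (δ : ℝ) (η : EuclideanSpace ℝ (Fin d))
    (u v : H1per M) : ℂ :=
  (∫ y in cell M, ∑ k, ∑ l,
      (B y k l : ℂ) * shiftedD Λ η u l y * starRingEnd ℂ (shiftedD Λ η v k y)) +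
    (δ : ℂ) * ∫ y in cell M, ∑ j, partialD u j y * starRingEnd ℂ (partialD v j y)

/-- `φ ∈ H¹_♯(Q)` is a regularized Bloch wave with regularized Bloch eigenvalue `lam`:
`φ ≠ 0` and `C^δ(η) φ = lam φ` in the weak sense. The form is Hermitian when `B` is symmetric,
so eigenvalues are real. -/
def IsBlochEigenpair {d M : ℕ} (Λ : Matrix (Fin M) (Fin d) ℝ)
    (B : (Fin M → ℝ) → Matrix (Fin d) (Fin d) ℝ) (δ : ℝ) (η : EuclideanSpace ℝ (Fin d))
    (lam : ℝ) (φ : H1per M) : Prop :=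
  φ ≠ 0 ∧ ∀ v : H1per M, blochForm Λ B δ η φ v =
    (lam : ℂ) * ∫ y in cell M, toL2 φ y * starRingEnd ℂ (toL2 v y)

/-- The set of regularized Bloch eigenvalues at the quasimomentum `η`. -/
def blochEigenvalues {d M : ℕ} (Λ : Matrix (Fin M) (Fin d) ℝ)
    (B : (Fin M → ℝ) → Matrix (Fin d) (Fin d) ℝ) (δ : ℝ) (η : EuclideanSpace ℝ (Fin d)) :
    Set ℝ :=
  {lam | ∃ φ : H1per M, IsBlochEigenpair Λ B δ η lam φ}

/-- The first regularized Bloch eigenvalue `λ₁^δ(η)`, the smallest one. -/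
def firstBlochEigenvalue {d M : ℕ} (Λ : Matrix (Fin M) (Fin d) ℝ)
    (B : (Fin M → ℝ) → Matrix (Fin d) (Fin d) ℝ) (δ : ℝ) (η : EuclideanSpace ℝ (Fin d)) : ℝ :=
  sInf (blochEigenvalues Λ B δ η)

/-- The set `Y' = [-1/2, 1/2)^d` of quasimomenta. -/
def dualCell (d : ℕ) : Set (EuclideanSpace ℝ (Fin d)) :=
  {η | ∀ k, η k ∈ Set.Ico (-(1 / 2) : ℝ) (1 / 2)}

end QuasiBloch

end

/-! At `η = 0` the constant `1` is an eigenfunction with eigenvalue `0`. As `B` is positive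
semidefinite, the form dominates `δ‖∇u‖²`, and Poincaré's inequality controls everything except the
mean; so the form is coercive up to the direction of `1` (`blochOp_coercive`). This eigenpair is
continued analytically to small `η`, without compactness or spectral theory.

On `H¹_♯(Q)` the form and the `L²` product are represented by bounded self-adjoint operators `L η`
(`blochOp`) and `K` (`massOp`), and the problem reads `L η u = λ K u` with `L` polynomial in `η`.
The implicit function theorem for `eigenMap` yields an analytic eigenvector `φ η` near `1` and an
analytic eigenvalue near `0`. An eigenvector for a smaller eigenvalue would be `K`-orthogonal to `φ
η`, hence almost `K`-orthogonal to `1`; coercivity would then keep its eigenvalue away from `0`, a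
contradiction. So the continued eigenvalue is the smallest one (`exists_analytic_lowest_eigenpair`).

The assumptions on `A` concern `B` only along the range of `Λ`. Kronecker's theorem
(`dense_range_mulVec_add`) extends symmetry and nonnegativity to all of `ℝ^M`; the coercivity
constant itself comes from `δ`. -/

noncomputable section

namespace QuasiBloch

/-! ### Analytic perturbation of a lowest eigenvalue in a Hilbert space -/

section Perturbation

open Filter Topology

local notation "⟪" x ", " y "⟫" => inner ℂ x y

variable {E H : Type*} [NormedAddCommGroup E] [NormedSpace ℝ E]
  [NormedAddCommGroup H] [InnerProductSpace ℂ H]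

/-- The nonlinear map whose zeros near `(0, e)` are the eigenvectors `u` of the pencil
`L η - lam • K` normalized by `⟪K e, u⟫ = κ`. -/
def eigenMap (L : E → H →L[ℂ] H) (K : H →L[ℂ] H) (e : H) (κ : ℝ) (p : E × H) : H :=
  (κ : ℂ) • L p.1 p.2 - ⟪e, L p.1 p.2⟫ • K p.2 + (⟪K e, p.2⟫ - κ) • K e

theorem contDiff_eigenMap {L : E → H →L[ℂ] H} (K : H →L[ℂ] H) (e : H) (κ : ℝ)
    (hL : ContDiff ℝ ω fun p : E × H => L p.1 p.2) : ContDiff ℝ ω (eigenMap L K e κ) := by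
  have hin : ∀ x : H, ContDiff ℝ ω fun u : H => ⟪x, u⟫ := fun x =>
    ((innerSL ℂ x).restrictScalars ℝ).contDiff
  have hK : ContDiff ℝ ω fun u : H => K u := (K.restrictScalars ℝ).contDiff
  have h1 : ContDiff ℝ ω fun p : E × H => (κ : ℂ) • L p.1 p.2 := hL.const_smul _
  have h2 : ContDiff ℝ ω fun p : E × H => ⟪e, L p.1 p.2⟫ • K p.2 :=
    ((hin e).comp hL).smul (hK.comp contDiff_snd)
  have h3 : ContDiff ℝ ω fun p : E × H => (⟪K e, p.2⟫ - κ) • K e :=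
    (((hin (K e)).comp contDiff_snd).sub contDiff_const).smul contDiff_const
  exact (h1.sub h2).add h3

-- Pairing the equation with `e` factors it as `(κ - ⟪e, L η u⟫) (⟪K e, u⟫ - κ) = 0`. Away from the
-- first root the normalization holds and the last term of `eigenMap` vanishes, so one equation
-- encodes both the normalization and the eigenvalue equation, with the eigenvalue eliminated.
omit [NormedAddCommGroup E] [NormedSpace ℝ E] in
theorem eigenMap_eq_zero {L : E → H →L[ℂ] H} {K : H →L[ℂ] H} {e : H} {κ : ℝ} (hκ : 0 < κ)
    (hKs : ∀ u v, ⟪u, K v⟫ = ⟪K u, v⟫) (hκe : ⟪e, K e⟫ = κ) {η : E} {u : H}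
    (h : eigenMap L K e κ (η, u) = 0) (hne : ⟪e, L η u⟫ ≠ κ) :
    L η u = (⟪e, L η u⟫ / κ) • K u := by
  have hκ' : (κ : ℂ) ≠ 0 := by exact_mod_cast hκ.ne'
  have h1 := congrArg (fun x => ⟪e, x⟫) h
  simp only [eigenMap, inner_add_right, inner_sub_right, inner_smul_right, inner_zero_right,
    hκe, hKs e u] at h1
  have h2 : ((κ : ℂ) - ⟪e, L η u⟫) * (⟪K e, u⟫ - κ) = 0 := by linear_combination h1
  have h3 : ⟪K e, u⟫ - κ = 0 := (mul_eq_zero.1 h2).resolve_left (sub_ne_zero.2 hne.symm)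
  simp only [eigenMap, h3, zero_smul, add_zero] at h
  rw [div_eq_inv_mul, mul_smul, ← sub_eq_zero.1 h, smul_smul, inv_mul_cancel₀ hκ', one_smul]

/-- The linearization of `eigenMap` in the second variable at `(0, e)`. -/
def eigenMapDeriv (L₀ K : H →L[ℂ] H) (e : H) (κ : ℝ) : H →L[ℂ] H :=
  (κ : ℂ) • L₀ + (innerSL ℂ (K e)).smulRight (K e)

-- The quadratic term drops out because `⟪e, L 0 u⟫ = ⟪L 0 e, u⟫ = 0`; the map is therefore affine
-- in `u` and its derivative can be read off.
omit [NormedSpace ℝ E] in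
theorem eigenMap_zero_left {L : E → H →L[ℂ] H} {K : H →L[ℂ] H} {e : H} {κ : ℝ}
    (hLs : ∀ η u v, ⟪u, L η v⟫ = ⟪L η u, v⟫) (hLe : L 0 e = 0) (u : H) :
    eigenMap L K e κ (0, u) = eigenMapDeriv (L 0) K e κ u - (κ : ℂ) • K e := by
  simp [eigenMap, eigenMapDeriv, hLs 0 e, hLe, sub_smul, add_sub_assoc]

variable [CompleteSpace H]

/-- Lax–Milgram: the rank-one term makes up for the degeneracy of `L₀` in the direction of `e`. -/
theorem isUnit_eigenMapDeriv {L₀ K : H →L[ℂ] H} {e : H} {κ c : ℝ} (hc : 0 < c)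
    (hLs : ∀ u v, ⟪u, L₀ v⟫ = ⟪L₀ u, v⟫)
    (hco : ∀ h, c * ‖h‖ ^ 2 ≤ κ * (⟪h, L₀ h⟫).re + ‖⟪K e, h⟫‖ ^ 2) :
    IsUnit (eigenMapDeriv L₀ K e κ) := by
  refine ContinuousLinearMap.isUnit_of_forall_le_norm_inner_map _ (c := ⟨c, hc.le⟩) hc fun h => ?_
  have h1 : (⟪eigenMapDeriv L₀ K e κ h, h⟫).re = κ * (⟪h, L₀ h⟫).re + ‖⟪K e, h⟫‖ ^ 2 := by
    have h2 : ⟪eigenMapDeriv L₀ K e κ h, h⟫ = κ * ⟪h, L₀ h⟫ + (‖⟪K e, h⟫‖ ^ 2 : ℝ) := by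
      simp only [eigenMapDeriv, _root_.add_apply, _root_.smul_apply,
        ContinuousLinearMap.smulRight_apply, innerSL_apply_apply, inner_add_left,
        inner_smul_left, Complex.conj_ofReal, ← hLs h h]
      rw [Complex.ofReal_pow, ← Complex.conj_mul']
    rw [h2, Complex.add_re, Complex.re_ofReal_mul, Complex.ofReal_re]
  calc ‖h‖ ^ 2 * c ≤ (⟪eigenMapDeriv L₀ K e κ h, h⟫).re := by rw [h1, mul_comm]; exact hco h
    _ ≤ _ := Complex.re_le_norm _

theorem isInvertible_fderiv_eigenMap {L : E → H →L[ℂ] H} {K : H →L[ℂ] H} {e : H} {κ c : ℝ}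
    (hc : 0 < c) (hL : ContDiff ℝ ω fun p : E × H => L p.1 p.2)
    (hLs : ∀ η u v, ⟪u, L η v⟫ = ⟪L η u, v⟫) (hLe : L 0 e = 0)
    (hco : ∀ h, c * ‖h‖ ^ 2 ≤ κ * (⟪h, L 0 h⟫).re + ‖⟪K e, h⟫‖ ^ 2) :
    (fderiv ℝ (eigenMap L K e κ) (0, e) ∘L .inr ℝ E H).IsInvertible := by
  have h1 : HasFDerivAt (fun u : H => eigenMap L K e κ (0, u))
      (fderiv ℝ (eigenMap L K e κ) (0, e) ∘L .inr ℝ E H) e :=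
    (((contDiff_eigenMap K e κ hL).differentiable (by simp)) (0, e)).hasFDerivAt.comp e
      (hasFDerivAt_prodMk_right 0 e)
  have h2 : HasFDerivAt (fun u : H => eigenMap L K e κ (0, u))
      ((eigenMapDeriv (L 0) K e κ).restrictScalars ℝ) e := by
    simp_rw [eigenMap_zero_left hLs hLe]
    exact ((eigenMapDeriv (L 0) K e κ).restrictScalars ℝ).hasFDerivAt.sub_const _
  rw [h1.unique h2]
  obtain ⟨S, hS⟩ := isUnit_eigenMapDeriv hc (hLs 0) hco
  refine ⟨(ContinuousLinearEquiv.unitsEquiv ℂ H S).restrictScalars ℝ, ?_⟩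
  ext u
  simp [← hS]

/-- **Analytic perturbation of a simple lowest eigenvalue.** Let `L η` be an analytic family of
self-adjoint bounded operators with `L 0 e = 0`, and let `K` be positive. If `L 0` is coercive up to
the direction of `e`, then for small `η` the smallest `lam` for which `L η - lam • K` has a
kernel is analytic in `η`, and so is a suitable kernel vector. -/
theorem exists_analytic_lowest_eigenpair [CompleteSpace E] {L : E → H →L[ℂ] H} {K : H →L[ℂ] H} {e : H} {κ c : ℝ}
    (hκ : 0 < κ) (hc : 0 < c) (hL : ContDiff ℝ ω fun p : E × H => L p.1 p.2)
    (hLc : Continuous L) (hLs : ∀ η u v, ⟪u, L η v⟫ = ⟪L η u, v⟫)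
    (hKs : ∀ u v, ⟪u, K v⟫ = ⟪K u, v⟫) (hKp : ∀ u, 0 ≤ (⟪u, K u⟫).re)
    (hκe : ⟪e, K e⟫ = κ) (hLe : L 0 e = 0)
    (hco : ∀ h, c * ‖h‖ ^ 2 ≤ κ * (⟪h, L 0 h⟫).re + ‖⟪K e, h⟫‖ ^ 2) :
    ∃ θ : ℝ, 0 < θ ∧ ∃ (lam : E → ℝ) (φ : E → H),
      AnalyticOnNhd ℝ lam (Metric.ball 0 θ) ∧ AnalyticOnNhd ℝ φ (Metric.ball 0 θ) ∧
      ∀ η ∈ Metric.ball (0 : E) θ, φ η ≠ 0 ∧ L η (φ η) = (lam η : ℂ) • K (φ η) ∧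
        ∀ (μ : ℝ) (u : H), u ≠ 0 → L η u = (μ : ℂ) • K u → lam η ≤ μ := by
  have cdf : ContDiffAt ℝ ω (eigenMap L K e κ) ((0 : E), e) :=
    (contDiff_eigenMap K e κ hL).contDiffAt
  have inv := isInvertible_fderiv_eigenMap hc hL hLs hLe hco
  set φ := cdf.implicitFunction (by simp) inv with hφ
  have hφ0 : φ 0 = e := cdf.implicitFunction_apply_self (by simp) inv
  have hφa : AnalyticAt ℝ φ 0 :=
    (cdf.contDiffAt_implicitFunction (by simp) inv).analyticAt
  have hG0 : eigenMap L K e κ ((0 : E), e) = 0 := by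
    rw [eigenMap_zero_left hLs hLe]
    simp [eigenMapDeriv, hLe, ← hKs e e, hκe]
  have hzero : ∀ᶠ η in 𝓝 (0 : E), eigenMap L K e κ (η, φ η) = 0 := by
    have := cdf.eventually_apply_implicitFunction (by simp) inv
    rwa [hG0] at this
  have hin : ∀ x : H, ContDiff ℝ ω fun u : H => ⟪x, u⟫ := fun x =>
    ((innerSL ℂ x).restrictScalars ℝ).contDiff
  have hLφa : ∀ᶠ η in 𝓝 (0 : E), AnalyticAt ℝ (fun η => ⟪e, L η (φ η)⟫) η := by
    filter_upwards [hφa.eventually_analyticAt] with η hη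
    have h1 : ContDiff ℝ ω fun p : E × H => ⟪e, L p.1 p.2⟫ := (hin e).comp hL
    have h2 : ContDiffAt ℝ ω (fun η => (η, φ η)) η := contDiffAt_id.prodMk hη.contDiffAt
    exact (h1.contDiffAt.comp η h2).analyticAt
  have hφc : ContinuousAt φ 0 := hφa.continuousAt
  set lam : E → ℝ := fun η => (⟪e, L η (φ η)⟫).re / κ with hlam
  have hcl : ContinuousAt (fun η => ⟪e, L η (φ η)⟫) 0 := hLφa.self_of_nhds.continuousAt
  have hcl0 : ⟪e, L 0 (φ 0)⟫ = 0 := by simp [hφ0, hLe]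
  have hne1 : ∀ᶠ η in 𝓝 (0 : E), ⟪e, L η (φ η)⟫ ≠ κ :=
    hcl.eventually_ne (by rw [hcl0]; exact_mod_cast hκ.ne)
  have hne2 : ∀ᶠ η in 𝓝 (0 : E), ⟪φ η, K (φ η)⟫ ≠ 0 := by
    refine ContinuousAt.eventually_ne (y := 0)
      (hφc.inner (𝕜 := ℂ) (K.continuous.continuousAt.comp hφc)) ?_
    simp only [hφ0, hκe]
    exact_mod_cast hκ.ne'
  -- the form of `L η` is coercive on the `K`-orthogonal complement of `φ η`
  have hgap : ∀ᶠ η in 𝓝 (0 : E), ‖K (e - φ η)‖ ^ 2 + κ * ‖L η - L 0‖ < c / 2 := by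
    have h1 : ContinuousAt (fun η => ‖K (e - φ η)‖ ^ 2 + κ * ‖L η - L 0‖) 0 :=
      (((K.continuous.continuousAt.comp (continuousAt_const.sub hφc)).norm.pow 2)).add
        (continuousAt_const.mul (hLc.continuousAt.sub continuousAt_const).norm)
    refine h1.eventually_lt continuousAt_const ?_
    simp [hφ0, hc]
  have hsmall : ∀ᶠ η in 𝓝 (0 : E), κ * lam η * ‖K‖ < c / 2 := by
    have h1 : ContinuousAt (fun η => κ * lam η * ‖K‖) 0 :=
      (continuousAt_const.mul
        ((Complex.continuous_re.continuousAt.comp hcl).div_const κ)).mul continuousAt_const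
    refine h1.eventually_lt continuousAt_const ?_
    simp [hlam, hφ0, hLe, hc]
  have hall := hzero.and <| hLφa.and <| hφa.eventually_analyticAt.and <| hne1.and <|
    hne2.and <| hgap.and hsmall
  obtain ⟨θ, hθ, hball⟩ := Metric.eventually_nhds_iff_ball.1 hall
  refine ⟨θ, hθ, lam, φ, ?_, ?_, ?_⟩
  · intro η hη
    have h1 := (hball η hη).2.1
    have h2 : AnalyticAt ℝ (fun z : ℂ => z.re) (⟪e, L η (φ η)⟫) :=
      Complex.reCLM.analyticAt _
    exact (h2.comp_of_eq h1 rfl).div analyticAt_const hκ.ne'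
  · exact fun η hη => (hball η hη).2.2.1
  · intro η hη
    obtain ⟨h0, -, -, h1, h2, h3, h4⟩ := hball η hη
    have hcplx := eigenMap_eq_zero hκ hKs hκe h0 h1
    have hreal : ⟪e, L η (φ η)⟫ / κ = (lam η : ℂ) := by
      -- Self-adjointness of `L η` and `K` shows that the eigenvalue times `⟪φ η, K (φ η)⟫ ≠ 0`
      -- equals its conjugate times the same number.
      have hs : (starRingEnd ℂ) (⟪e, L η (φ η)⟫ / κ) = ⟪e, L η (φ η)⟫ / κ := by
        have h5 := hLs η (φ η) (φ η)
        rw [hcplx, inner_smul_right, inner_smul_left, ← hKs] at h5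
        exact (mul_right_cancel₀ h2 h5).symm
      rw [← Complex.conj_eq_iff_re.1 hs, Complex.div_ofReal_re]
    rw [hreal] at hcplx
    refine ⟨fun h => h2 (by simp [h]), hcplx, fun μ u hu hμ => ?_⟩
    by_contra! hlt
    -- Eigenvectors for distinct real eigenvalues are `K`-orthogonal, so `e` may be replaced by the
    -- small vector `e - φ η` in `⟪K e, u⟫`.
    have horth : ⟪K (φ η), u⟫ = 0 := by
      have h5 := hLs η (φ η) u
      rw [hcplx, hμ, inner_smul_right, inner_smul_left, Complex.conj_ofReal, hKs] at h5
      have h6 : ((μ : ℂ) - lam η) * ⟪K (φ η), u⟫ = 0 := by linear_combination h5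
      refine (mul_eq_zero.1 h6).resolve_left ?_
      exact_mod_cast (sub_neg.2 hlt).ne
    have hu2 : 0 < ‖u‖ ^ 2 := by positivity
    have hA : ‖⟪K e, u⟫‖ ^ 2 ≤ ‖K (e - φ η)‖ ^ 2 * ‖u‖ ^ 2 := by
      have h6 : ⟪K e, u⟫ = ⟪K (e - φ η), u⟫ := by rw [map_sub, inner_sub_left, horth, sub_zero]
      rw [h6, ← mul_pow]
      gcongr
      exact norm_inner_le_norm _ _
    have hB : (⟪u, L 0 u⟫).re ≤ (⟪u, L η u⟫).re + ‖L η - L 0‖ * ‖u‖ ^ 2 := by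
      have h6 : ⟪u, L 0 u⟫ = ⟪u, L η u⟫ - ⟪u, (L η - L 0) u⟫ := by
        simp
      have h7 : ‖⟪u, (L η - L 0) u⟫‖ ≤ ‖L η - L 0‖ * ‖u‖ ^ 2 := by
        calc ‖⟪u, (L η - L 0) u⟫‖ ≤ ‖u‖ * ‖(L η - L 0) u‖ := norm_inner_le_norm _ _
          _ ≤ ‖u‖ * (‖L η - L 0‖ * ‖u‖) := by gcongr; exact ContinuousLinearMap.le_opNorm _ _
          _ = _ := by ring
      have h8 := (abs_le.1 (Complex.abs_re_le_norm ⟪u, (L η - L 0) u⟫)).1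
      rw [h6, Complex.sub_re]
      linarith
    have hC : (⟪u, L η u⟫).re = μ * (⟪u, K u⟫).re := by
      rw [hμ, inner_smul_right, Complex.re_ofReal_mul]
    have hD : (⟪u, K u⟫).re ≤ ‖K‖ * ‖u‖ ^ 2 :=
      calc (⟪u, K u⟫).re ≤ ‖u‖ * ‖K u‖ := (Complex.re_le_norm _).trans (norm_inner_le_norm _ _)
        _ ≤ ‖u‖ * (‖K‖ * ‖u‖) := by gcongr; exact ContinuousLinearMap.le_opNorm _ _
        _ = _ := by ring
    have hE := hco u
    have hF : c / 2 * ‖u‖ ^ 2 < κ * μ * (⟪u, K u⟫).re := by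
      have := mul_lt_mul_of_pos_right h3 hu2
      have h9 := mul_le_mul_of_nonneg_left hB hκ.le
      rw [hC] at h9
      nlinarith
    have hpos := hKp u
    have hG : κ * μ * (⟪u, K u⟫).re ≤ κ * lam η * (⟪u, K u⟫).re := by gcongr
    -- The contradiction is `c/2 ‖u‖² < κ μ ⟪u, K u⟫ ≤ κ lam ⟪u, K u⟫ ≤ κ lam ‖K‖ ‖u‖² < c/2 ‖u‖²`.
    -- The third inequality needs `lam η ≥ 0`, which the first two force since `⟪u, K u⟫ ≥ 0`.
    have hlpos : 0 ≤ κ * lam η := by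
      by_contra! hneg
      nlinarith [mul_nonneg hpos (neg_nonneg.2 hneg.le)]
    have hI := mul_le_mul_of_nonneg_left hD hlpos
    have hJ := mul_lt_mul_of_pos_right h4 hu2
    nlinarith

end Perturbation

/-! ### Kronecker's density theorem via Haar measure -/

section Kronecker

open UnitAddTorus

/-- A character of a compact group that is nontrivial integrates to zero against an invariant
measure. -/
theorem integral_eq_zero_of_translate {G : Type*} [AddGroup G] [MeasurableSpace G]
    [MeasurableAdd G] (μ : Measure G) [μ.IsAddLeftInvariant] {χ : G → ℂ}
    (hχ : ∀ x y, χ (x + y) = χ x * χ y) {g : G} (hg : χ g ≠ 1) : ∫ x, χ x ∂μ = 0 := by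
  have h1 : ∫ x, χ x ∂μ = χ g * ∫ x, χ x ∂μ := by
    rw [← integral_const_mul, ← integral_add_left_eq_self χ g]
    simp_rw [hχ]
  have h2 : (χ g - 1) * ∫ x, χ x ∂μ = 0 := by linear_combination -h1
  exact (mul_eq_zero.1 h2).resolve_left (sub_ne_zero.2 hg)

theorem mFourier_add_apply {ι : Type*} [Fintype ι] (p : ι → ℤ) (x y : UnitAddTorus ι) :
    mFourier p (x + y) = mFourier p x * mFourier p y := by
  simp [mFourier, fourier_apply, smul_add, AddCircle.toCircle_add, Finset.prod_mul_distrib]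

/-- Finite measures on the torus are determined by their Fourier coefficients. -/
theorem measure_ext_of_mFourier {ι : Type*} [Fintype ι] {P P' : Measure (UnitAddTorus ι)}
    [IsFiniteMeasure P] [IsFiniteMeasure P']
    (h : ∀ p : ι → ℤ, ∫ x, mFourier p x ∂P = ∫ x, mFourier p x ∂P') : P = P' := by
  have hcont : ∀ (ρ : Measure (UnitAddTorus ι)) [IsFiniteMeasure ρ],
      Continuous fun f : C(UnitAddTorus ι, ℂ) => ∫ x, f x ∂ρ := by
    intro ρ _
    have h1 := (continuous_integral (μ := ρ) (G := ℂ)).comp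
      (ContinuousMap.toLp (E := ℂ) 1 ρ ℂ).continuous
    refine h1.congr fun f => ?_
    exact integral_congr_ae (ContinuousMap.coeFn_toLp ρ f)
  have hint : ∀ (ρ : Measure (UnitAddTorus ι)) [IsFiniteMeasure ρ] (f : C(UnitAddTorus ι, ℂ)),
      Integrable f ρ := fun ρ _ f =>
    f.continuous.integrable_of_hasCompactSupport (HasCompactSupport.of_compactSpace _)
  have hall : ∀ f : C(UnitAddTorus ι, ℂ), ∫ x, f x ∂P = ∫ x, f x ∂P' := by
    have hclosed : IsClosed {f : C(UnitAddTorus ι, ℂ) | ∫ x, f x ∂P = ∫ x, f x ∂P'} :=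
      isClosed_eq (hcont P) (hcont P')
    have hsub : (Submodule.span ℂ (Set.range (mFourier (d := ι))) : Set C(UnitAddTorus ι, ℂ)) ⊆
        {f | ∫ x, f x ∂P = ∫ x, f x ∂P'} := by
      intro f hf
      induction hf using Submodule.span_induction with
      | mem f hf => obtain ⟨p, rfl⟩ := hf; exact h p
      | zero => simp
      | add f g _ _ hf hg =>
        simp only [Set.mem_ofPred_eq, ContinuousMap.add_apply] at hf hg ⊢
        rw [integral_add (hint P f) (hint P g), integral_add (hint P' f) (hint P' g), hf, hg]
      | smul c f _ hf =>
        simp only [Set.mem_ofPred_eq, ContinuousMap.smul_apply] at hf ⊢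
        rw [integral_smul, integral_smul, hf]
    intro f
    have h2 : f ∈ (Submodule.span ℂ (Set.range (mFourier (d := ι)))).topologicalClosure := by
      rw [span_mFourier_closure_eq_top]; trivial
    exact closure_minimal hsub hclosed h2
  refine ext_of_forall_integral_eq_of_IsFiniteMeasure fun f => ?_
  have h3 := hall ⟨fun x => (f x : ℂ), by fun_prop⟩
  simp only [ContinuousMap.coe_mk, integral_complex_ofReal] at h3
  exact_mod_cast h3

/-- A subgroup of the torus that is annihilated by no nontrivial character is dense. -/
theorem dense_addSubgroup_of_mFourier {ι : Type*} [Fintype ι] (S : AddSubgroup (UnitAddTorus ι))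
    (hS : ∀ p : ι → ℤ, p ≠ 0 → ∃ h ∈ S, mFourier p h ≠ 1) : Dense (S : Set (UnitAddTorus ι)) := by
  set H := S.topologicalClosure with hH
  have hHc : IsClosed (H : Set (UnitAddTorus ι)) := S.isClosed_topologicalClosure
  have : CompactSpace H := isCompact_iff_compactSpace.1 hHc.isCompact
  let ν : Measure H := Measure.addHaar
  let μ : Measure (UnitAddTorus ι) := Measure.addHaar
  have hm : Measurable ((↑) : H → UnitAddTorus ι) := measurable_subtype_coe
  -- The cross factors equalize the total masses, that is, the coefficients at `p = 0`; at `p ≠ 0`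
  -- both sides integrate to zero. Equality makes the open complement of `H` a null set, hence
  -- empty.
  have heq : μ Set.univ • ν.map (↑) = ν Set.univ • μ := by
    have : IsFiniteMeasure (μ Set.univ • ν.map ((↑) : H → UnitAddTorus ι)) :=
      Measure.smul_finite _ (measure_ne_top _ _)
    have : IsFiniteMeasure (ν Set.univ • μ) := Measure.smul_finite _ (measure_ne_top _ _)
    refine measure_ext_of_mFourier fun p => ?_
    rw [integral_smul_measure, integral_smul_measure,
      integral_map hm.aemeasurable (mFourier p).continuous.aestronglyMeasurable]
    by_cases hp : p = 0
    · subst hp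
      simp [mFourier_zero, Measure.real, mul_comm]
    · obtain ⟨h, hhS, hh⟩ := hS p hp
      rw [integral_eq_zero_of_translate μ (mFourier_add_apply p) hh,
        integral_eq_zero_of_translate ν (χ := fun x : H => mFourier p x)
          (g := ⟨h, S.le_topologicalClosure hhS⟩) (fun x y => mFourier_add_apply p x y) hh]
      simp
  have h0 : μ (H : Set (UnitAddTorus ι))ᶜ = 0 := by
    have h1 := congrArg (fun m => m (H : Set (UnitAddTorus ι))ᶜ) heq
    simp only [Measure.smul_apply, smul_eq_mul] at h1
    rw [Measure.map_apply hm hHc.measurableSet.compl] at h1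
    have h2 : ((↑) : H → UnitAddTorus ι) ⁻¹' (H : Set (UnitAddTorus ι))ᶜ = ∅ := by
      ext x; simp
    rw [h2, measure_empty, mul_zero] at h1
    refine (mul_eq_zero.1 h1.symm).resolve_left ?_
    exact (Measure.measure_univ_pos.2 (NeZero.ne ν)).ne'
  have h1 := (hHc.isOpen_compl.measure_eq_zero_iff μ).1 h0
  rw [Set.compl_empty_iff] at h1
  rw [dense_iff_closure_eq, ← AddSubgroup.topologicalClosure_coe, ← hH, h1]

/-- **Kronecker's theorem**: if `Λᵀ p ≠ 0` for all nonzero integer vectors `p`, then the translates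
of the range of `Λ` by `2π ℤ^M` form a dense set. -/
theorem dense_range_mulVec_add {d M : ℕ} (Λ : Matrix (Fin M) (Fin d) ℝ)
    (hΛ : ∀ p : Fin M → ℤ, p ≠ 0 → Λᵀ *ᵥ (fun j => (p j : ℝ)) ≠ 0) :
    Dense {y : Fin M → ℝ | ∃ (x : Fin d → ℝ) (p : Fin M → ℤ),
      y = fun j => (Λ *ᵥ x) j + 2 * Real.pi * (p j : ℝ)} := by
  have hpi : (2 * Real.pi : ℝ) ≠ 0 := by positivity
  let q : (Fin M → ℝ) →+ UnitAddTorus (Fin M) :=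
    { toFun := fun y j => ((y j / (2 * Real.pi) : ℝ) : UnitAddCircle)
      map_zero' := by ext j; simp
      map_add' := fun x y => by ext j; simp [add_div] }
  let lin : (Fin d → ℝ) →+ (Fin M → ℝ) := Λ.mulVecLin.toAddMonoidHom
  have hopen : IsOpenMap q := by
    have h1 : IsOpenMap (Pi.map fun (_ : Fin M) (t : ℝ) =>
        ((t / (2 * Real.pi) : ℝ) : UnitAddCircle)) := by
      refine IsOpenMap.piMap (fun _ => ?_) (by simp)
      exact QuotientAddGroup.isOpenMap_coe.comp (Homeomorph.mulRight₀ _ (inv_ne_zero hpi)).isOpenMap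
    exact h1
  have hd := dense_addSubgroup_of_mFourier (q.comp lin).range (fun p hp => by
    obtain ⟨k, hk⟩ := Function.ne_iff.1 (hΛ p hp)
    set a := (Λᵀ *ᵥ (fun j => (p j : ℝ))) k with ha
    have ha0 : a ≠ 0 := hk
    -- With `x = (π / a) e_k` one has `p · Λx = π`, so the character takes the value `exp(iπ) = -1`.
    refine ⟨_, ⟨Pi.single k (Real.pi / a), rfl⟩, ?_⟩
    have h1 : mFourier p ((q.comp lin) (Pi.single k (Real.pi / a))) = -1 := by
      have h2 : ∑ j, 2 * Real.pi * Complex.I * p j * ((Λ j k * (Real.pi / a) / (2 * Real.pi) : ℝ) : ℂ)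
          = Real.pi * Complex.I := by
        have h3 : ∑ j, Λ j k * (p j : ℝ) = a := by
          simp [ha, Matrix.mulVec, dotProduct]
        have h4 : ∑ j, (Λ j k : ℂ) * (p j : ℂ) = a := by exact_mod_cast congrArg Complex.ofReal h3
        have h5 : (a : ℂ) ≠ 0 := by exact_mod_cast ha0
        have h6 : (Real.pi : ℂ) ≠ 0 := by exact_mod_cast Real.pi_ne_zero
        calc _ = ∑ j, ((Λ j k : ℂ) * (p j : ℂ)) * (Real.pi * Complex.I / a) := by
              refine Finset.sum_congr rfl fun j _ => ?_
              push_cast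
              field_simp
          _ = _ := by rw [← Finset.sum_mul, h4]; field_simp
      have h7 : ∀ j, fourier (p j) ((q.comp lin) (Pi.single k (Real.pi / a)) j) =
          Complex.exp (2 * Real.pi * Complex.I * p j *
            ((Λ j k * (Real.pi / a) / (2 * Real.pi) : ℝ) : ℂ)) := by
        intro j
        have h8 : (q.comp lin) (Pi.single k (Real.pi / a)) j =
            ((Λ j k * (Real.pi / a) / (2 * Real.pi) : ℝ) : UnitAddCircle) := by
          simp [q, lin, div_eq_mul_inv]
        rw [h8, fourier_coe_apply]
        simp
      simp only [mFourier, ContinuousMap.coe_mk]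
      rw [Finset.prod_congr rfl fun j _ => h7 j, ← Complex.exp_sum, h2, Complex.exp_pi_mul_I]
    rw [h1]
    norm_num)
  -- Preimages of dense sets under open maps are dense; the integer vector `p` is the ambiguity of
  -- lifts from the torus.
  refine (hd.preimage hopen).mono ?_
  rintro y ⟨x, hx⟩
  have h1 : ∀ j, ∃ n : ℤ, y j = (Λ *ᵥ x) j + 2 * Real.pi * (n : ℝ) := by
    intro j
    have h2 := congrFun hx j
    have h3 : (((Λ *ᵥ x) j / (2 * Real.pi) : ℝ) : UnitAddCircle) =
      ((y j / (2 * Real.pi) : ℝ) : UnitAddCircle) := h2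
    rw [← sub_eq_zero, ← AddCircle.coe_sub, AddCircle.coe_eq_zero_iff] at h3
    obtain ⟨n, hn⟩ := h3
    refine ⟨-n, ?_⟩
    simp only [zsmul_eq_mul, mul_one] at hn
    field_simp at hn
    push_cast
    linarith
  choose p hp using h1
  exact ⟨x, p, funext hp⟩

/-- A continuous `2π`-periodic function that is nonnegative almost everywhere along a nonresonant
linear map is nonnegative everywhere. -/
theorem nonneg_of_ae_nonneg_comp_mulVec {d M : ℕ} {Λ : Matrix (Fin M) (Fin d) ℝ}
    (hΛ : ∀ p : Fin M → ℤ, p ≠ 0 → Λᵀ *ᵥ (fun j => (p j : ℝ)) ≠ 0) {f : (Fin M → ℝ) → ℝ}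
    (hf : Continuous f)
    (hper : ∀ (y : Fin M → ℝ) (p : Fin M → ℤ), f (fun j => y j + 2 * Real.pi * (p j : ℝ)) = f y)
    (h : ∀ᵐ x : Fin d → ℝ, 0 ≤ f (Λ *ᵥ x)) (y : Fin M → ℝ) : 0 ≤ f y := by
  have hall : ∀ x : Fin d → ℝ, 0 ≤ f (Λ *ᵥ x) := by
    have hc : IsClosed {x : Fin d → ℝ | 0 ≤ f (Λ *ᵥ x)} :=
      isClosed_le continuous_const (hf.comp (by fun_prop))
    exact fun x => hc.closure_subset ((Measure.dense_of_ae h) x)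
  have hc : IsClosed {y | 0 ≤ f y} := isClosed_le continuous_const hf
  refine hc.closure_subset_iff.2 ?_ (dense_range_mulVec_add Λ hΛ y)
  rintro _ ⟨x, p, rfl⟩
  simpa only [Set.mem_ofPred_eq, hper] using hall x

/-! ### Transfer of symmetry and positivity from `A` to `B` -/

section Coefficient

variable {d M : ℕ} {A : (Fin d → ℝ) → Matrix (Fin d) (Fin d) ℝ}
  {B : (Fin M → ℝ) → Matrix (Fin d) (Fin d) ℝ} {Λ : Matrix (Fin M) (Fin d) ℝ}

/-- The equality follows from two inequalities, each extended from the range of `Λ` by density. -/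
theorem isSymm_of_comp_isSymm (hB : ∀ k l, Continuous fun y => B y k l)
    (hB_per : ∀ (y : Fin M → ℝ) (p : Fin M → ℤ),
      B (fun j => y j + 2 * Real.pi * (p j : ℝ)) = B y)
    (hAB : ∀ x, A x = B (Λ *ᵥ x))
    (hΛ : ∀ p : Fin M → ℤ, p ≠ 0 → Λᵀ *ᵥ (fun j => (p j : ℝ)) ≠ 0)
    (hA_symm : ∀ x, (A x).IsSymm) (y : Fin M → ℝ) (k l : Fin d) : B y k l = B y l k := by
  have key : ∀ k l, 0 ≤ B y k l - B y l k := fun k l =>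
    nonneg_of_ae_nonneg_comp_mulVec hΛ (f := fun y => B y k l - B y l k) ((hB k l).sub (hB l k))
      (fun y p => by simp only [hB_per])
      (Filter.Eventually.of_forall fun x => by
        simp only [← hAB, (hA_symm x).apply k l, sub_self, le_refl]) y
  linarith [key k l, key l k]

theorem nonneg_of_comp_coercive (hB : ∀ k l, Continuous fun y => B y k l)
    (hB_per : ∀ (y : Fin M → ℝ) (p : Fin M → ℤ),
      B (fun j => y j + 2 * Real.pi * (p j : ℝ)) = B y)
    (hAB : ∀ x, A x = B (Λ *ᵥ x))
    (hΛ : ∀ p : Fin M → ℤ, p ≠ 0 → Λᵀ *ᵥ (fun j => (p j : ℝ)) ≠ 0)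
    (hA : ∃ α : ℝ, 0 < α ∧ ∀ v : Fin d → ℝ, ∀ᵐ x : Fin d → ℝ,
      α * (v ⬝ᵥ v) ≤ (A x *ᵥ v) ⬝ᵥ v) (y : Fin M → ℝ) (v : Fin d → ℝ) :
    0 ≤ (B y *ᵥ v) ⬝ᵥ v := by
  obtain ⟨α, hα, h⟩ := hA
  have hBc : Continuous B := continuous_matrix hB
  refine nonneg_of_ae_nonneg_comp_mulVec hΛ (f := fun y => (B y *ᵥ v) ⬝ᵥ v) (by fun_prop)
    (fun y p => by simp only [hB_per]) ?_ y
  filter_upwards [h v] with x hx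
  rw [← hAB]
  exact (mul_nonneg hα.le (Finset.sum_nonneg fun i _ => mul_self_nonneg (v i))).trans hx

/-- The real part of the complex form of a real positive semidefinite matrix is nonnegative. -/
theorem re_sum_mul_conj_nonneg {S : Matrix (Fin d) (Fin d) ℝ}
    (hp : ∀ v, 0 ≤ (S *ᵥ v) ⬝ᵥ v) (z : Fin d → ℂ) :
    0 ≤ (∑ k, ∑ l, (S k l : ℂ) * z l * starRingEnd ℂ (z k)).re := by
  have h1 : (∑ k, ∑ l, (S k l : ℂ) * z l * starRingEnd ℂ (z k)).re =
      (S *ᵥ fun k => (z k).re) ⬝ᵥ (fun k => (z k).re) +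
        (S *ᵥ fun k => (z k).im) ⬝ᵥ (fun k => (z k).im) := by
    simp only [dotProduct, Matrix.mulVec, Complex.re_sum, Finset.sum_mul,
      ← Finset.sum_add_distrib]
    refine Finset.sum_congr rfl fun k _ => Finset.sum_congr rfl fun l _ => ?_
    simp
  rw [h1]
  exact add_nonneg (hp _) (hp _)

end Coefficient

end Kronecker

/-! ### Fourier series on the cell and Poincaré's inequality -/

section Fourier

open UnitAddTorus

attribute [local instance] instMeasureSpaceUnitAddCircle

/-- The parametrization of the cell by the unit torus. -/
def torusToCell (M : ℕ) (t : UnitAddTorus (Fin M)) : Fin M → ℝ :=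
  (2 * Real.pi : ℝ) • (measurableEquivPiIoc (fun _ => (0 : ℝ)) t).1

/-- The unit torus has mass `1` and the cell has mass `(2π)^M`, whence the factor. This carries
Fourier theory from `UnitAddTorus` to the cell. -/
theorem measurePreserving_torusToCell (M : ℕ) :
    MeasurePreserving (torusToCell M) volume
      (ENNReal.ofReal (((2 * Real.pi) ^ M)⁻¹) • (volume.restrict (cell M))) := by
  have hpi : (0 : ℝ) < 2 * Real.pi := by positivity
  have hpos : (0 : ℝ) < ((2 * Real.pi) ^ M)⁻¹ := by positivity
  set S : Set (Fin M → ℝ) := Set.univ.pi fun _ => Set.Ioc 0 (2 * Real.pi) with hS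
  have hSm : MeasurableSet S := MeasurableSet.univ_pi fun _ => measurableSet_Ioc
  -- The torus representatives lie in half-open intervals closed on the right, the cell is closed on
  -- the left; the difference is a null set.
  have hSc : (volume : Measure (Fin M → ℝ)).restrict S = volume.restrict (cell M) :=
    Measure.restrict_congr_set ((Measure.univ_pi_Ioc_ae_eq_Icc).trans
      (Measure.univ_pi_Ico_ae_eq_Icc).symm)
  have h1 := measurePreserving_equivPiIoc (d := Fin M) (fun _ => (0 : ℝ))
  have hm : MeasurableSet {x : Fin M → ℝ | ∀ i, x i ∈ Set.Ioc (0 : ℝ) (0 + 1)} :=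
    MeasurableSet.univ_pi' fun _ => measurableSet_Ioc
  have h2 := measurePreserving_subtype_coe (μa := (volume : Measure (Fin M → ℝ))) hm
  have h3 : MeasurePreserving (fun x : Fin M → ℝ => (2 * Real.pi : ℝ) • x) volume
      (ENNReal.ofReal (((2 * Real.pi) ^ M)⁻¹) • volume) := by
    refine ⟨measurable_const_smul _, ?_⟩
    rw [Measure.map_addHaar_smul _ hpi.ne', Module.finrank_fin_fun, abs_of_pos hpos]
  have h4 := h3.restrict_preimage hSm
  have h5 : (fun x : Fin M → ℝ => (2 * Real.pi : ℝ) • x) ⁻¹' S =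
      {x : Fin M → ℝ | ∀ i, x i ∈ Set.Ioc (0 : ℝ) (0 + 1)} := by
    ext x
    simp only [hS, Set.mem_preimage, Set.mem_pi, Set.mem_univ, true_imp_iff, Pi.smul_apply,
      smul_eq_mul, Set.mem_Ioc, Set.mem_ofPred_eq, zero_add, hpi, mul_pos_iff_of_pos_left,
      mul_le_iff_le_one_right]
  rw [h5, Measure.restrict_smul, hSc] at h4
  exact h4.comp (h2.comp h1)

theorem integral_cell_eq {M : ℕ} {F : (Fin M → ℝ) → ℂ}
    (hF : AEStronglyMeasurable F (volume.restrict (cell M))) :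
    ∫ t, F (torusToCell M t) = ((2 * Real.pi : ℝ) : ℂ)⁻¹ ^ M * ∫ y in cell M, F y := by
  have h := measurePreserving_torusToCell M
  rw [← integral_map h.aemeasurable (by rw [h.map_eq]; exact hF.smul_measure _), h.map_eq,
    integral_smul_measure, ENNReal.toReal_ofReal (by positivity)]
  rw [Complex.real_smul, Complex.ofReal_inv, Complex.ofReal_pow, inv_pow]

theorem mFourier_eq_exp {M : ℕ} (n : Fin M → ℤ) (t : UnitAddTorus (Fin M)) :
    mFourier (-n) t =
      Complex.exp (-(Complex.I * ∑ j, (n j : ℂ) * (torusToCell M t j : ℂ))) := by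
  have h1 : ∀ j, t j = (((measurableEquivPiIoc (fun _ => (0 : ℝ)) t).1 j : ℝ) : UnitAddCircle) :=
    fun j => congrFun ((measurableEquivPiIoc (fun _ => (0 : ℝ))).symm_apply_apply t).symm j
  simp only [mFourier, ContinuousMap.coe_mk]
  rw [Finset.mul_sum, ← Finset.sum_neg_distrib, Complex.exp_sum]
  refine Finset.prod_congr rfl fun j _ => ?_
  rw [h1 j, fourier_coe_apply, torusToCell]
  congr 1
  simp
  ring

theorem memLp_comp_torusToCell {M : ℕ} (u : L2per M) :
    MemLp (u ∘ torusToCell M) 2 (volume : Measure (UnitAddTorus (Fin M))) :=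
  ((Lp.memLp u).smul_measure ENNReal.ofReal_ne_top).comp_measurePreserving
    (measurePreserving_torusToCell M)

theorem mFourierCoeff_comp_torusToCell {M : ℕ} (u : L2per M) (n : Fin M → ℤ) :
    mFourierCoeff ((memLp_comp_torusToCell u).toLp _) n = fourierCoef u n := by
  rw [fourierCoef, ← integral_cell_eq (integrable_fourier u n).aestronglyMeasurable, mFourierCoeff]
  refine integral_congr_ae ?_
  filter_upwards [(memLp_comp_torusToCell u).coeFn_toLp] with t ht
  rw [ht, mFourier_eq_exp, smul_eq_mul, mul_comm, Function.comp]

theorem norm_sq_L2per {M : ℕ} (u : L2per M) :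
    ‖u‖ ^ 2 = ∫ y in cell M, ‖u y‖ ^ 2 := by
  have h1 : (inner ℂ u u).re = ∫ y in cell M, ‖u y‖ ^ 2 := by
    rw [L2.inner_def, ← RCLike.re_eq_complex_re, ← integral_re (L2.integrable_inner u u)]
    simp only [inner_self_eq_norm_sq]
  rw [← h1]
  exact (inner_self_eq_norm_sq (𝕜 := ℂ) u).symm

/-- **Parseval's identity** on the cell. -/
theorem hasSum_norm_fourierCoef_sq {M : ℕ} (u : L2per M) :
    HasSum (fun n => ‖fourierCoef u n‖ ^ 2) (((2 * Real.pi) ^ M)⁻¹ * ‖u‖ ^ 2) := by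
  have h1 := hasSum_sq_mFourierCoeff ((memLp_comp_torusToCell u).toLp _)
  simp_rw [mFourierCoeff_comp_torusToCell] at h1
  convert h1 using 1
  have h2 : ∫ t, ‖(memLp_comp_torusToCell u).toLp _ t‖ ^ 2 = ∫ t, ‖u (torusToCell M t)‖ ^ 2 := by
    refine integral_congr_ae ?_
    filter_upwards [(memLp_comp_torusToCell u).coeFn_toLp] with t ht
    rw [ht, Function.comp]
  have h3 := integral_cell_eq (F := fun y => ((‖u y‖ ^ 2 : ℝ) : ℂ))
    (Complex.continuous_ofReal.comp_aestronglyMeasurable ((Lp.aestronglyMeasurable u).norm.pow 2))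
  rw [integral_complex_ofReal, integral_complex_ofReal, ← norm_sq_L2per] at h3
  rw [h2, ← inv_pow]
  exact_mod_cast h3.symm

instance isFiniteMeasure_cell (M : ℕ) :
    IsFiniteMeasure ((volume : Measure (Fin M → ℝ)).restrict (cell M)) := by
  refine ⟨?_⟩
  rw [Measure.restrict_apply_univ, cell, Real.volume_pi_Ico]
  exact ENNReal.prod_lt_top fun _ _ => ENNReal.ofReal_lt_top

theorem fourierCoef_const {M : ℕ} (n : Fin M → ℤ) (hn : n ≠ 0) :
    fourierCoef (Lp.const 2 (volume.restrict (cell M)) (1 : ℂ)) n = 0 := by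
  have h1 : fourierCoef (Lp.const 2 (volume.restrict (cell M)) (1 : ℂ)) n =
      ∫ t : UnitAddTorus (Fin M), mFourier (-n) t := by
    simp_rw [mFourier_eq_exp]
    rw [integral_cell_eq (F := fun y : Fin M → ℝ =>
      Complex.exp (-(Complex.I * ∑ j, (n j : ℂ) * (y j : ℂ))))
      (Continuous.aestronglyMeasurable (by fun_prop)), fourierCoef]
    congr 1
    refine integral_congr_ae ?_
    filter_upwards [Lp.coeFn_const 2 (volume.restrict (cell M)) (1 : ℂ)] with y hy
    rw [hy, Function.const, one_mul]
  -- The constant `1` is the character of index `0`, orthogonal to the one of index `n`.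
  have h2 := orthonormal_mFourier.2 hn
  simpa only [ContinuousMap.inner_toLp, ← mFourier_neg, ← mFourier_add, zero_add, ← h1] using h2

theorem fourierCoef_zero_index {M : ℕ} (u : L2per M) :
    inner ℂ (Lp.const 2 (volume.restrict (cell M)) (1 : ℂ)) u =
      ((2 * Real.pi : ℝ) : ℂ) ^ M * fourierCoef u 0 := by
  have hpi : ((2 * Real.pi : ℝ) : ℂ) ≠ 0 := by exact_mod_cast (by positivity)
  rw [fourierCoef, ← mul_assoc, ← mul_pow, mul_inv_cancel₀ hpi, one_pow, one_mul, L2.inner_def]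
  refine integral_congr_ae ?_
  filter_upwards [Lp.coeFn_const 2 (volume.restrict (cell M)) (1 : ℂ)] with y hy
  rw [RCLike.inner_apply, hy]
  simp

theorem inner_const_self (M : ℕ) :
    inner ℂ (Lp.const 2 (volume.restrict (cell M)) (1 : ℂ))
      (Lp.const 2 (volume.restrict (cell M)) (1 : ℂ)) = (((2 * Real.pi) ^ M : ℝ) : ℂ) := by
  have h1 : ∫ y in cell M, (1 : ℂ) = (((2 * Real.pi) ^ M : ℝ) : ℂ) := by
    rw [setIntegral_const, Measure.real, cell, Real.volume_pi_Ico]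
    simp [Real.pi_pos.le]
  rw [← h1, L2.inner_def]
  refine integral_congr_ae ?_
  filter_upwards [Lp.coeFn_const 2 (volume.restrict (cell M)) (1 : ℂ)] with y hy
  rw [RCLike.inner_apply, hy]
  simp

theorem norm_sq_eq_tsum {M : ℕ} (u : L2per M) :
    ‖u‖ ^ 2 = (2 * Real.pi) ^ M * ∑' n, ‖fourierCoef u n‖ ^ 2 := by
  rw [(hasSum_norm_fourierCoef_sq u).tsum_eq, ← mul_assoc, mul_inv_cancel₀ (by positivity), one_mul]

/-- **Poincaré's inequality** in `H¹_♯(Q)`. -/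
theorem poincare {M : ℕ} (w : H1per M) :
    ‖toL2 w‖ ^ 2 ≤ (2 * Real.pi) ^ M * ‖fourierCoef (toL2 w) 0‖ ^ 2 +
      ∑ j, ‖partialD w j‖ ^ 2 := by
  have hw : ∀ j n, ‖fourierCoef (partialD w j) n‖ ^ 2 =
      (n j : ℝ) ^ 2 * ‖fourierCoef (toL2 w) n‖ ^ 2 := by
    intro j n
    have h1 : fourierCoef (partialD w j) n = Complex.I * (n j : ℂ) * fourierCoef (toL2 w) n :=
      w.2 j n
    rw [h1, norm_mul, norm_mul, Complex.norm_I, one_mul, mul_pow, Complex.norm_intCast, sq_abs]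
  have hs0 := (hasSum_norm_fourierCoef_sq (toL2 w)).summable
  have hsj := fun j => (hasSum_norm_fourierCoef_sq (partialD w j)).summable
  have hsum : Summable fun n : Fin M → ℤ => ∑ j, ‖fourierCoef (partialD w j) n‖ ^ 2 :=
    summable_sum fun j _ => hsj j
  -- Writing the mean as a one-term series allows a termwise comparison: equality of the zeroth
  -- terms up to a nonnegative summand, and `|n|² ≥ 1` for `n ≠ 0`.
  have hsingle := hasSum_ite_eq (0 : Fin M → ℤ) (‖fourierCoef (toL2 w) 0‖ ^ 2)
  have key : ∑' n, ‖fourierCoef (toL2 w) n‖ ^ 2 ≤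
      ‖fourierCoef (toL2 w) 0‖ ^ 2 + ∑ j, ∑' n, ‖fourierCoef (partialD w j) n‖ ^ 2 := by
    rw [← Summable.tsum_finsetSum fun j _ => hsj j, ← hsingle.tsum_eq,
      ← hsingle.summable.tsum_add hsum]
    refine hs0.tsum_le_tsum (fun n => ?_) (hsingle.summable.add hsum)
    by_cases hn : n = 0
    · rw [if_pos hn, hn]
      exact le_add_of_nonneg_right (Finset.sum_nonneg fun j _ => sq_nonneg _)
    · rw [if_neg hn, zero_add]
      simp_rw [hw, ← Finset.sum_mul]
      obtain ⟨i, hi⟩ := Function.ne_iff.1 hn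
      have h2 : (1 : ℝ) ≤ ∑ j, (n j : ℝ) ^ 2 := by
        calc (1 : ℝ) ≤ (n i : ℝ) ^ 2 := by
              have h3 : 1 ≤ n i ^ 2 := Int.one_le_abs hi |>.trans (by
                rw [← sq_abs]; nlinarith [Int.one_le_abs hi])
              exact_mod_cast h3
          _ ≤ _ := Finset.single_le_sum (f := fun j => (n j : ℝ) ^ 2)
              (fun j _ => sq_nonneg _) (Finset.mem_univ i)
      exact le_mul_of_one_le_left (sq_nonneg _) h2
  simp_rw [norm_sq_eq_tsum, ← Finset.mul_sum]
  rw [← mul_add]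
  exact mul_le_mul_of_nonneg_left key (by positivity)

end Fourier

/-! ### Regularity of operators quadratic in the parameter -/

section AffineFamilies

open ContinuousLinearMap (adjoint)

variable {E G H ι : Type*} [NormedAddCommGroup E] [NormedSpace ℝ E]
  [NormedAddCommGroup G] [InnerProductSpace ℂ G] [CompleteSpace G]
  [NormedAddCommGroup H] [InnerProductSpace ℂ H] [CompleteSpace H] [Fintype ι]
  {T : E → ι → H →L[ℂ] G} {T₀ : ι → H →L[ℂ] G} {C : H →L[ℂ] G} {a : ι → E →L[ℝ] ℝ}

omit [CompleteSpace G] [CompleteSpace H] in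
theorem contDiff_clm_comp_snd (S : H →L[ℂ] G) : ContDiff ℝ ω fun p : E × H => S p.2 :=
  (S.restrictScalars ℝ).contDiff.comp contDiff_snd

omit [CompleteSpace G] [CompleteSpace H] in
theorem contDiff_affine_apply (S₀ S : H →L[ℂ] G) {c : E → ℂ} (hc : ContDiff ℝ ω c) :
    ContDiff ℝ ω fun p : E × H => (S₀ + c p.1 • S) p.2 := by
  have h1 : ContDiff ℝ ω fun p : E × H => c p.1 := hc.comp contDiff_fst
  exact (contDiff_clm_comp_snd S₀).add (h1.smul (contDiff_clm_comp_snd S))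

omit [CompleteSpace G] [CompleteSpace H] in
theorem contDiff_apply_comp {S : E → G →L[ℂ] H} {w : E × H → G}
    (hS : ContDiff ℝ ω fun p : E × G => S p.1 p.2) (hw : ContDiff ℝ ω w) :
    ContDiff ℝ ω fun p : E × H => S p.1 (w p) :=
  hS.comp (contDiff_fst.prodMk hw)

/-- Continuity here is in operator norm, as the estimate of `‖L η - L 0‖` requires. -/
theorem continuous_sum_adjoint_comp (hT : ∀ η k, T η k = T₀ k + (Complex.I * (a k η : ℂ)) • C)
    (m : ι → ι → G →L[ℂ] G) (R : H →L[ℂ] H) :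
    Continuous fun η => (∑ k, ∑ l, adjoint (T η k) ∘L m k l ∘L T η l) + R := by
  have h1 : ∀ k, Continuous fun η => T η k := fun k => by
    simp_rw [hT]
    fun_prop
  have h2 : ∀ k, Continuous fun η => adjoint (T η k) := fun k =>
    adjoint.continuous.comp (h1 k)
  refine (continuous_finsetSum _ fun k _ => continuous_finsetSum _ fun l _ => ?_).add
    continuous_const
  exact (h2 k).clm_comp (continuous_const.clm_comp (h1 l))

theorem contDiff_sum_adjoint_comp_apply
    (hT : ∀ η k, T η k = T₀ k + (Complex.I * (a k η : ℂ)) • C)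
    (m : ι → ι → G →L[ℂ] G) (R : H →L[ℂ] H) :
    ContDiff ℝ ω fun p : E × H =>
      ((∑ k, ∑ l, adjoint (T p.1 k) ∘L m k l ∘L T p.1 l) + R) p.2 := by
  have hc : ∀ k, ContDiff ℝ ω fun η => Complex.I * (a k η : ℂ) := fun k =>
    contDiff_const.mul (Complex.ofRealCLM.contDiff.comp (a k).contDiff)
  have h1 : ∀ l, ContDiff ℝ ω fun p : E × H => T p.1 l p.2 := fun l => by
    simp_rw [hT]
    exact contDiff_affine_apply _ _ (hc l)
  -- The adjoint conjugates the scalar coefficient, which is harmless because analyticity is over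
  -- `ℝ`.
  have h2 : ∀ k, ContDiff ℝ ω fun p : E × G => adjoint (T p.1 k) p.2 := fun k => by
    simp_rw [hT, map_add, map_smulₛₗ]
    exact contDiff_affine_apply _ _ (Complex.conjCLE.contDiff.comp (hc k))
  have h3 : ∀ k l, ContDiff ℝ ω fun p : E × H => adjoint (T p.1 k) (m k l (T p.1 l p.2)) :=
    fun k l => contDiff_apply_comp (S := fun η => adjoint (T η k))
      (w := fun p => m k l (T p.1 l p.2)) (h2 k)
      (((m k l).restrictScalars ℝ).contDiff.comp (h1 l))
  have h4 : (fun p : E × H => ((∑ k, ∑ l, adjoint (T p.1 k) ∘L m k l ∘L T p.1 l) + R) p.2) =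
      fun p => (∑ k, ∑ l, adjoint (T p.1 k) (m k l (T p.1 l p.2))) + R p.2 := by
    ext p
    simp only [add_apply, sum_apply, ContinuousLinearMap.comp_apply]
  rw [h4]
  exact (ContDiff.sum fun k _ => ContDiff.sum fun l _ => h3 k l).add (contDiff_clm_comp_snd R)

end AffineFamilies

/-! ### The Bloch form as a bounded operator on `H¹_♯(Q)` -/

section Operators

theorem norm_fourierCoef_sq_le {M : ℕ} (u : L2per M) (n : Fin M → ℤ) :
    ‖fourierCoef u n‖ ^ 2 ≤ ((2 * Real.pi) ^ M)⁻¹ * ‖u‖ ^ 2 :=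
  le_hasSum (hasSum_norm_fourierCoef_sq u) n fun _ _ => sq_nonneg _

theorem continuous_fourierCoef {M : ℕ} (n : Fin M → ℤ) :
    Continuous fun u : L2per M => fourierCoef u n := by
  let f : L2per M →ₗ[ℂ] ℂ :=
    { toFun := fun u => fourierCoef u n
      map_add' := fun u v => fourierCoef_add u v n
      map_smul' := fun c u => fourierCoef_smul c u n }
  refine AddMonoidHomClass.continuous_of_bound f (Real.sqrt ((2 * Real.pi) ^ M)⁻¹) fun u => ?_
  refine le_of_sq_le_sq ?_ (by positivity)
  rw [mul_pow, Real.sq_sqrt (by positivity)]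
  exact norm_fourierCoef_sq_le u n

/-- Every defining condition equates two continuous functionals. Closedness gives completeness,
without which the adjoints below would not exist. -/
theorem isClosed_H1perSubmodule (M : ℕ) :
    IsClosed (H1perSubmodule M : Set (PiLp 2 fun _ : Option (Fin M) => L2per M)) := by
  have h1 : (H1perSubmodule M : Set (PiLp 2 fun _ : Option (Fin M) => L2per M)) =
      ⋂ (j : Fin M) (n : Fin M → ℤ), {w | fourierCoef (w (some j)) n =
        Complex.I * (n j : ℂ) * fourierCoef (w none) n} := by
    ext w
    simp [H1perSubmodule]
  rw [h1]
  refine isClosed_iInter fun j => isClosed_iInter fun n => isClosed_eq ?_ ?_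
  · exact (continuous_fourierCoef n).comp (PiLp.continuous_apply 2 _ (some j))
  · exact continuous_const.mul ((continuous_fourierCoef n).comp (PiLp.continuous_apply 2 _ none))

instance completeSpace_H1per (M : ℕ) : CompleteSpace (H1per M) :=
  (isClosed_H1perSubmodule M).completeSpace_coe

/-- The components of an element of `H¹_♯(Q)`: the function itself and its partial derivatives. -/
def component (M : ℕ) (i : Option (Fin M)) : H1per M →L[ℂ] L2per M :=
  (PiLp.proj 2 (fun _ : Option (Fin M) => L2per M) i).comp (H1perSubmodule M).subtypeL

@[simp]
theorem component_none {M : ℕ} (u : H1per M) : component M none u = toL2 u := rfl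

@[simp]
theorem component_some {M : ℕ} (u : H1per M) (j : Fin M) :
    component M (some j) u = partialD u j := rfl

theorem norm_sq_H1per {M : ℕ} (u : H1per M) :
    ‖u‖ ^ 2 = ‖toL2 u‖ ^ 2 + ∑ j, ‖partialD u j‖ ^ 2 := by
  rw [← Submodule.norm_coe, PiLp.norm_sq_eq_of_L2, Fintype.sum_option]
  rfl

/-- The constant function `1`. -/
def oneH1 (M : ℕ) : H1per M :=
  ⟨WithLp.toLp 2 fun i => i.elim (Lp.const 2 (volume.restrict (cell M)) (1 : ℂ)) fun _ => 0, by
    intro j n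
    have h0 : fourierCoef (0 : L2per M) n = 0 := by
      simpa using fourierCoef_smul 0 (0 : L2per M) n
    by_cases hn : n = 0
    · simp [hn, hn ▸ h0]
    · simp [fourierCoef_const n hn, h0]⟩

@[simp]
theorem toL2_oneH1 (M : ℕ) :
    toL2 (oneH1 M) = Lp.const 2 (volume.restrict (cell M)) (1 : ℂ) := rfl

@[simp]
theorem partialD_oneH1 (M : ℕ) (j : Fin M) : partialD (oneH1 M) j = 0 := rfl

theorem memLp_top_cell {M : ℕ} {b : (Fin M → ℝ) → ℝ} (hb : Continuous b) :
    MemLp (fun y => (b y : ℂ)) ⊤ ((volume : Measure (Fin M → ℝ)).restrict (cell M)) := by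
  have hc : IsCompact (Set.univ.pi fun _ : Fin M => Set.Icc (0 : ℝ) (2 * Real.pi)) :=
    isCompact_univ_pi fun _ => isCompact_Icc
  obtain ⟨C, hC⟩ := hc.exists_bound_of_continuousOn hb.continuousOn
  refine memLp_top_of_bound (Continuous.aestronglyMeasurable (by fun_prop)) C ?_
  refine ae_restrict_of_forall_mem (MeasurableSet.univ_pi fun _ => measurableSet_Ico) fun y hy => ?_
  rw [Complex.norm_real]
  exact hC y fun j hj => Set.Ico_subset_Icc_self (hy j hj)

/-- Multiplication by a continuous real function on `L²_♯(Q)`. -/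
def mulOp {M : ℕ} {b : (Fin M → ℝ) → ℝ} (hb : Continuous b) : L2per M →L[ℂ] L2per M :=
  (ContinuousLinearMap.mul ℂ ℂ).holderL (volume.restrict (cell M)) ⊤ 2 2 (memLp_top_cell hb).toLp

theorem coeFn_mulOp {M : ℕ} {b : (Fin M → ℝ) → ℝ} (hb : Continuous b) (u : L2per M) :
    mulOp hb u =ᵐ[volume.restrict (cell M)] fun y => (b y : ℂ) * u y := by
  have h1 := (ContinuousLinearMap.mul ℂ ℂ).coeFn_holder (r := 2) (memLp_top_cell hb).toLp u
  filter_upwards [h1, (memLp_top_cell hb).coeFn_toLp] with y hy hy'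
  rw [← hy']
  exact hy

theorem mulOp_congr {M : ℕ} {b b' : (Fin M → ℝ) → ℝ} (hb : Continuous b) (hb' : Continuous b')
    (h : b = b') : mulOp hb = mulOp hb' := by
  subst h
  rfl

theorem inner_mulOp_right {M : ℕ} {b : (Fin M → ℝ) → ℝ} (hb : Continuous b) (x z : L2per M) :
    inner ℂ x (mulOp hb z) = inner ℂ (mulOp hb x) z := by
  rw [L2.inner_def, L2.inner_def]
  refine integral_congr_ae ?_
  filter_upwards [coeFn_mulOp hb x, coeFn_mulOp hb z] with y hx hz
  rw [hx, hz, RCLike.inner_apply, RCLike.inner_apply, map_mul, Complex.conj_ofReal]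
  ring

variable {d M : ℕ} {B : (Fin M → ℝ) → Matrix (Fin d) (Fin d) ℝ}

theorem inner_mulOp_ae (hB : ∀ k l, Continuous fun y => B y k l) (x z : Fin d → L2per M) :
    (fun y => ∑ k, ∑ l, inner ℂ (x k y) (mulOp (hB k l) (z l) y))
      =ᵐ[volume.restrict (cell M)]
    fun y => ∑ k, ∑ l, (B y k l : ℂ) * z l y * starRingEnd ℂ (x k y) := by
  have h1 : ∀ᵐ y ∂((volume : Measure (Fin M → ℝ)).restrict (cell M)),
      ∀ k l, mulOp (hB k l) (z l) y = (B y k l : ℂ) * z l y := by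
    simp_rw [ae_all_iff]
    exact fun k l => coeFn_mulOp (hB k l) (z l)
  filter_upwards [h1] with y hy
  simp_rw [hy, RCLike.inner_apply]

theorem integrable_matrixForm (hB : ∀ k l, Continuous fun y => B y k l)
    (x z : Fin d → L2per M) :
    Integrable (fun y => ∑ k, ∑ l, (B y k l : ℂ) * z l y * starRingEnd ℂ (x k y))
      (volume.restrict (cell M)) :=
  (integrable_finsetSum _ fun k _ => integrable_finsetSum _ fun l _ =>
    L2.integrable_inner (x k) (mulOp (hB k l) (z l))).congr (inner_mulOp_ae hB x z)

theorem sum_inner_mulOp (hB : ∀ k l, Continuous fun y => B y k l) (x z : Fin d → L2per M) :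
    ∑ k, ∑ l, inner ℂ (x k) (mulOp (hB k l) (z l)) =
      ∫ y in cell M, ∑ k, ∑ l, (B y k l : ℂ) * z l y * starRingEnd ℂ (x k y) := by
  rw [← integral_congr_ae (inner_mulOp_ae hB x z), integral_finsetSum _ fun k _ =>
    integrable_finsetSum _ fun l _ => L2.integrable_inner (x k) (mulOp (hB k l) (z l))]
  refine Finset.sum_congr rfl fun k _ => ?_
  rw [integral_finsetSum _ fun l _ => L2.integrable_inner (x k) (mulOp (hB k l) (z l))]
  rfl

theorem re_sum_inner_mulOp_nonneg (hB : ∀ k l, Continuous fun y => B y k l)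
    (hp : ∀ y v, 0 ≤ (B y *ᵥ v) ⬝ᵥ v) (x : Fin d → L2per M) :
    0 ≤ (∑ k, ∑ l, inner ℂ (x k) (mulOp (hB k l) (x l))).re := by
  rw [sum_inner_mulOp, ← RCLike.re_eq_complex_re, ← integral_re (integrable_matrixForm hB x x)]
  exact integral_nonneg fun y => re_sum_mul_conj_nonneg (hp y) fun k => x k y

/-- The `k`-th component of `D + iη` as a bounded operator `H¹_♯(Q) → L²_♯(Q)`. -/
def shiftedDOp (Λ : Matrix (Fin M) (Fin d) ℝ) (η : EuclideanSpace ℝ (Fin d)) (k : Fin d) :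
    H1per M →L[ℂ] L2per M :=
  (∑ j, (Λ j k : ℂ) • component M (some j)) + (Complex.I * (η k : ℂ)) • component M none

theorem shiftedDOp_apply (Λ : Matrix (Fin M) (Fin d) ℝ) (η : EuclideanSpace ℝ (Fin d)) (k : Fin d)
    (u : H1per M) : shiftedDOp Λ η k u = shiftedD Λ η u k := by
  simp [shiftedDOp, shiftedD]

open ContinuousLinearMap (adjoint)

theorem shiftedDOp_eq (Λ : Matrix (Fin M) (Fin d) ℝ) (η : EuclideanSpace ℝ (Fin d)) (k : Fin d) :
    shiftedDOp Λ η k = (∑ j, (Λ j k : ℂ) • component M (some j)) +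
      (Complex.I * (EuclideanSpace.proj (𝕜 := ℝ) k η : ℂ)) • component M none := rfl

/-- The bounded operator on `H¹_♯(Q)` representing the form `blochForm`. -/
def blochOp (hB : ∀ k l, Continuous fun y => B y k l) (Λ : Matrix (Fin M) (Fin d) ℝ) (δ : ℝ)
    (η : EuclideanSpace ℝ (Fin d)) : H1per M →L[ℂ] H1per M :=
  (∑ k, ∑ l, adjoint (shiftedDOp Λ η k) ∘L mulOp (hB k l) ∘L shiftedDOp Λ η l) +
    (δ : ℂ) • ∑ j, adjoint (component M (some j)) ∘L component M (some j)

/-- The bounded operator on `H¹_♯(Q)` representing the `L²` inner product. -/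
def massOp (M : ℕ) : H1per M →L[ℂ] H1per M :=
  adjoint (component M none) ∘L component M none

theorem inner_massOp (u v : H1per M) : inner ℂ u (massOp M v) = inner ℂ (toL2 u) (toL2 v) := by
  rw [massOp, ContinuousLinearMap.comp_apply, ContinuousLinearMap.adjoint_inner_right]
  rfl

theorem inner_massOp_left (u v : H1per M) : inner ℂ (massOp M u) v = inner ℂ (toL2 u) (toL2 v) := by
  rw [massOp, ContinuousLinearMap.comp_apply, ContinuousLinearMap.adjoint_inner_left]
  rfl

variable (hB : ∀ k l, Continuous fun y => B y k l) (Λ : Matrix (Fin M) (Fin d) ℝ) (δ : ℝ)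

theorem inner_blochOp (η : EuclideanSpace ℝ (Fin d)) (u v : H1per M) :
    inner ℂ v (blochOp hB Λ δ η u) =
      ∑ k, ∑ l, inner ℂ (shiftedD Λ η v k) (mulOp (hB k l) (shiftedD Λ η u l)) +
        (δ : ℂ) * ∑ j, inner ℂ (partialD v j) (partialD u j) := by
  simp [blochOp, ContinuousLinearMap.adjoint_inner_right, shiftedDOp_apply]

theorem inner_blochOp_eq_blochForm (η : EuclideanSpace ℝ (Fin d)) (u v : H1per M) :
    inner ℂ v (blochOp hB Λ δ η u) = blochForm Λ B δ η u v := by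
  rw [inner_blochOp, sum_inner_mulOp, blochForm]
  congr 2
  simp_rw [L2.inner_def]
  rw [← integral_finsetSum _ fun j _ => L2.integrable_inner (partialD v j) (partialD u j)]
  rfl

theorem continuous_blochOp : Continuous (blochOp hB Λ δ) :=
  continuous_sum_adjoint_comp (fun η k => shiftedDOp_eq Λ η k) _ _

theorem contDiff_blochOp :
    ContDiff ℝ ω fun p : EuclideanSpace ℝ (Fin d) × H1per M => blochOp hB Λ δ p.1 p.2 :=
  contDiff_sum_adjoint_comp_apply (fun η k => shiftedDOp_eq Λ η k) _ _

variable {hB Λ δ}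

/-- Multiplication by a real function is self-adjoint, and symmetry of `B` absorbs the exchange of
`k` and `l` under conjugation. -/
theorem inner_blochOp_comm (hs : ∀ y k l, B y k l = B y l k) (η : EuclideanSpace ℝ (Fin d))
    (u v : H1per M) :
    inner ℂ u (blochOp hB Λ δ η v) = inner ℂ (blochOp hB Λ δ η u) v := by
  have hm : ∀ k l, mulOp (hB k l) = mulOp (hB l k) := fun k l =>
    mulOp_congr _ _ (funext fun y => hs y k l)
  rw [← inner_conj_symm _ v, inner_blochOp, inner_blochOp]
  simp only [map_add, map_sum, map_mul, inner_conj_symm, Complex.conj_ofReal]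
  congr 1
  rw [Finset.sum_comm]
  refine Finset.sum_congr rfl fun l _ => Finset.sum_congr rfl fun k _ => ?_
  rw [hm k l, inner_mulOp_right]

theorem blochOp_zero_oneH1 : blochOp hB Λ δ 0 (oneH1 M) = 0 := by
  have h1 : ∀ k, shiftedD Λ 0 (oneH1 M) k = 0 := fun k => by simp [shiftedD]
  refine ext_inner_left ℂ fun v => ?_
  rw [inner_blochOp]
  simp [h1]

theorem blochOp_coercive (hδ : 0 < δ) (hδ1 : δ < 1) (hp : ∀ y v, 0 ≤ (B y *ᵥ v) ⬝ᵥ v)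
    (h : H1per M) :
    (2 * Real.pi) ^ M * δ / 2 * ‖h‖ ^ 2 ≤
      (2 * Real.pi) ^ M * (inner ℂ h (blochOp hB Λ δ 0 h)).re +
        ‖(inner ℂ (massOp M (oneH1 M)) h : ℂ)‖ ^ 2 := by
  have hκ : (0 : ℝ) < (2 * Real.pi) ^ M := by positivity
  set κ : ℝ := (2 * Real.pi) ^ M with hκd
  have h1 : ‖(inner ℂ (massOp M (oneH1 M)) h : ℂ)‖ ^ 2 =
      κ * (κ * ‖fourierCoef (toL2 h) 0‖ ^ 2) := by
    rw [inner_massOp_left, toL2_oneH1, fourierCoef_zero_index, norm_mul, norm_pow,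
      Complex.norm_real, Real.norm_of_nonneg (by positivity), mul_pow]
    ring
  have h2 : δ * ∑ j, ‖partialD h j‖ ^ 2 ≤ (inner ℂ h (blochOp hB Λ δ 0 h)).re := by
    have h3 : (∑ j, inner ℂ (partialD h j) (partialD h j) : ℂ).re = ∑ j, ‖partialD h j‖ ^ 2 := by
      rw [Complex.re_sum]
      exact Finset.sum_congr rfl fun j _ => inner_self_eq_norm_sq (𝕜 := ℂ) _
    rw [inner_blochOp, Complex.add_re, Complex.re_ofReal_mul, h3]
    exact le_add_of_nonneg_left (re_sum_inner_mulOp_nonneg hB hp _)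
  have h4 := poincare h
  rw [h1, norm_sq_H1per]
  set X := κ * ‖fourierCoef (toL2 h) 0‖ ^ 2
  set Y := ∑ j, ‖partialD h j‖ ^ 2
  have hX : 0 ≤ X := by positivity
  -- Poincaré gives `‖h‖² ≤ X + 2Y` in `H¹`; the factor `δ / 2` turns `2Y` into the available `δ Y`,
  -- and `δ / 2 ≤ 1` takes care of `X`.
  calc κ * δ / 2 * (‖toL2 h‖ ^ 2 + Y) ≤ κ * δ / 2 * (X + Y + Y) := by gcongr
    _ = κ * (δ * Y) + κ * (δ / 2 * X) := by ring
    _ ≤ κ * (inner ℂ h (blochOp hB Λ δ 0 h)).re + κ * X := by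
      gcongr
      nlinarith

theorem isBlochEigenpair_iff {η : EuclideanSpace ℝ (Fin d)} {lam : ℝ} {φ : H1per M} :
    IsBlochEigenpair Λ B δ η lam φ ↔
      φ ≠ 0 ∧ blochOp hB Λ δ η φ = (lam : ℂ) • massOp M φ := by
  have h1 : ∀ v : H1per M, ∫ y in cell M, toL2 φ y * starRingEnd ℂ (toL2 v y) =
      inner ℂ v (massOp M φ) := fun v => by
    rw [inner_massOp, L2.inner_def]
    rfl
  rw [IsBlochEigenpair, and_congr_right_iff]
  intro _
  have h2 : ∀ v : H1per M, (lam : ℂ) * inner ℂ v (massOp M φ) =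
      inner ℂ v ((lam : ℂ) • massOp M φ) := fun v =>
    (inner_smul_right (𝕜 := ℂ) v (massOp M φ) (lam : ℂ)).symm
  refine ⟨fun h => ext_inner_left ℂ fun v => ?_, fun h v => ?_⟩
  · rw [inner_blochOp_eq_blochForm, h v, h1, h2]
  · rw [← inner_blochOp_eq_blochForm hB, h1, h2, h]

end Operators

theorem ball_subset_dualCell {d : ℕ} {θ : ℝ} (hθ : θ ≤ 1 / 2) :
    Metric.ball (0 : EuclideanSpace ℝ (Fin d)) θ ⊆ dualCell d := by
  intro η hη k
  have h1 := abs_lt.1 (((PiLp.norm_apply_le η k).trans_lt (mem_ball_zero_iff.1 hη)).trans_le hθ)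
  exact ⟨h1.1.le, h1.2⟩

end QuasiBloch

end

/-! ### The theorem -/

theorem theorem4p1 (d M : ℕ) (hdM : d < M)
    (A : (Fin d → ℝ) → Matrix (Fin d) (Fin d) ℝ)
    (B : (Fin M → ℝ) → Matrix (Fin d) (Fin d) ℝ)
    (Λ : Matrix (Fin M) (Fin d) ℝ)
    -- the coefficients `a_{kl}` are smooth and bounded
    (hA_smooth : ∀ k l, ContDiff ℝ ∞ (fun x => A x k l))
    (hA_bdd : ∀ k l, ∃ K : ℝ, ∀ x, |A x k l| ≤ K)
    -- `A` is quasiperiodic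
    (hB_smooth : ∀ k l, ContDiff ℝ ∞ (fun y => B y k l))
    (hB_per : ∀ (y : Fin M → ℝ) (p : Fin M → ℤ),
      B (fun j => y j + 2 * Real.pi * (p j : ℝ)) = B y)
    (hAB : ∀ x, A x = B (Λ *ᵥ x))
    (hΛ : ∀ p : Fin M → ℤ, p ≠ 0 → Λᵀ *ᵥ (fun j => (p j : ℝ)) ≠ 0)
    -- `A` is symmetric
    (hA_symm : ∀ x, (A x).IsSymm)
    -- `A` is coercive
    (hA_coercive : ∃ α : ℝ, 0 < α ∧ ∀ v : Fin d → ℝ, ∀ᵐ x : Fin d → ℝ,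
      α * (v ⬝ᵥ v) ≤ (A x *ᵥ v) ⬝ᵥ v)
    (δ : ℝ) (hδ_pos : 0 < δ) (hδ_lt : δ < 1) :
    ∃ θ : ℝ, 0 < θ ∧ Metric.ball (0 : EuclideanSpace ℝ (Fin d)) θ ⊆ QuasiBloch.dualCell d ∧
      -- `λ₁^δ(η)` is an eigenvalue, the smallest one
      (∀ η ∈ Metric.ball (0 : EuclideanSpace ℝ (Fin d)) θ,
        IsLeast (QuasiBloch.blochEigenvalues Λ B δ η)
          (QuasiBloch.firstBlochEigenvalue Λ B δ η)) ∧
      AnalyticOnNhd ℝ (fun η => QuasiBloch.firstBlochEigenvalue Λ B δ η)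
        (Metric.ball (0 : EuclideanSpace ℝ (Fin d)) θ) ∧
      ∃ φ : EuclideanSpace ℝ (Fin d) → QuasiBloch.H1per M,
        (∀ η ∈ Metric.ball (0 : EuclideanSpace ℝ (Fin d)) θ,
          QuasiBloch.IsBlochEigenpair Λ B δ η
            (QuasiBloch.firstBlochEigenvalue Λ B δ η) (φ η)) ∧
        AnalyticOnNhd ℝ φ (Metric.ball (0 : EuclideanSpace ℝ (Fin d)) θ) := by
  have hB : ∀ k l, Continuous fun y => B y k l := fun k l => (hB_smooth k l).continuous
  have hs := QuasiBloch.isSymm_of_comp_isSymm hB hB_per hAB hΛ hA_symm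
  have hp := QuasiBloch.nonneg_of_comp_coercive hB hB_per hAB hΛ hA_coercive
  have hκ : (0 : ℝ) < (2 * Real.pi) ^ M := by positivity
  obtain ⟨θ, hθ, lam, φ, hlam, hφ, hpair⟩ := QuasiBloch.exists_analytic_lowest_eigenpair
    (L := QuasiBloch.blochOp hB Λ δ) (K := QuasiBloch.massOp M) (e := QuasiBloch.oneH1 M)
    (κ := (2 * Real.pi) ^ M) (c := (2 * Real.pi) ^ M * δ / 2) hκ (by positivity)
    (QuasiBloch.contDiff_blochOp hB Λ δ) (QuasiBloch.continuous_blochOp hB Λ δ)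
    (fun η u v => QuasiBloch.inner_blochOp_comm hs η u v)
    (fun u v => by rw [QuasiBloch.inner_massOp, QuasiBloch.inner_massOp_left])
    (fun u => by
      rw [QuasiBloch.inner_massOp]
      exact inner_self_nonneg (𝕜 := ℂ))
    (by rw [QuasiBloch.inner_massOp]; exact QuasiBloch.inner_const_self M)
    QuasiBloch.blochOp_zero_oneH1 (QuasiBloch.blochOp_coercive hδ_pos hδ_lt hp)
  -- The cap `1/2` keeps the ball inside `Y'`, as `|η_k| ≤ |η|`.
  have hsub : Metric.ball (0 : EuclideanSpace ℝ (Fin d)) (min θ (1 / 2)) ⊆ Metric.ball 0 θ :=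
    Metric.ball_subset_ball (min_le_left _ _)
  have hleast : ∀ η ∈ Metric.ball (0 : EuclideanSpace ℝ (Fin d)) (min θ (1 / 2)),
      IsLeast (QuasiBloch.blochEigenvalues Λ B δ η) (lam η) := fun η hη => by
    obtain ⟨h0, h1, h2⟩ := hpair η (hsub hη)
    refine ⟨⟨φ η, (QuasiBloch.isBlochEigenpair_iff (hB := hB)).2 ⟨h0, h1⟩⟩, ?_⟩
    rintro μ ⟨u, hu⟩
    obtain ⟨hu0, hu1⟩ := (QuasiBloch.isBlochEigenpair_iff (hB := hB)).1 hu
    exact h2 μ u hu0 hu1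
  have hfirst : ∀ η ∈ Metric.ball (0 : EuclideanSpace ℝ (Fin d)) (min θ (1 / 2)),
      QuasiBloch.firstBlochEigenvalue Λ B δ η = lam η := fun η hη => (hleast η hη).csInf_eq
  refine ⟨min θ (1 / 2), by positivity, QuasiBloch.ball_subset_dualCell (min_le_right _ _),
    fun η hη => ?_, ?_, φ, fun η hη => ?_, hφ.mono hsub⟩
  · rw [hfirst η hη]
    exact hleast η hη
  · exact (hlam.mono hsub).congr Metric.isOpen_ball fun η hη => (hfirst η hη).symm
  · rw [hfirst η hη]
    obtain ⟨h0, h1, -⟩ := hpair η (hsub hη)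
    exact (QuasiBloch.isBlochEigenpair_iff (hB := hB)).2 ⟨h0, h1⟩
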